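/- Consider a discounted stochastic game with a principal (player $0$) and $n\ge 0$ agents (players $1,\dots,n$): a finite state space $S$ with an initial state, a finite nonempty action set $A$ for each player, joint actions $\mathbf A=A^{n+1}$, transition probabilities $p(\cdot\mid s,\mathbf a)\in\Delta(S)$, a discount factor $\gamma\in[0,1)$, and rewards $r_i(s,\mathbf a)\in[-\frac{1-\gamma}{2},\frac{1-\gamma}{2}]$, $\mathbf r=(r_0,\dots,r_n)$. Let $\Sigma$ be the set of finite (possibly empty) sequences of triples (state, recommended joint action, performed joint action). A policy is a map $\pi:\Sigma\times S\to\Delta(\mathbf A)$, and a deviation plan of agent $i$ is a map $\rho:\Sigma\times S\times A\to A$. When $\mathbf a$ is recommended after $(\sigma;s)$, the joint action performed under $\rho$ is $\mathbf a'=\mathbf a\oplus_i\rho(\sigma;s,a_i)$, i.e. $\mathbf a$ with $a_i$ replaced by $\rho(\sigma;s,a_i)$. Let $V^{\pi,\rho}(\sigma;s)\in\mathbb R^{n+1}$ be the vector of the players' expected discounted reward sums from the present step on, given $(\sigma;s)$, and let $$Q^{\pi,\rho}(\sigma;s,\mathbf a)=\mathbf r(s,\mathbf a')+\gamma\,\mathbb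 E_{s'\sim p(\cdot\mid s,\mathbf a')}V^{\pi,\rho}\big(\sigma;(s,\mathbf a,\mathbf a');s'\big).$$ Write $V^\pi,Q^\pi$ when nobody deviates. The policy $\pi$ is a correlated equilibrium (CE) if for every agent $i\in\{1,\dots,n\}$, every $(\sigma;s,a)\in\Sigma\times S\times A$ and every deviation plan $\rho$ of agent $i$, $$\sum_{\mathbf a:\,a_i=a}\pi(\mathbf a\mid\sigma;s)\,Q_i^{\pi}(\sigma;s,\mathbf a)\ \ge\ \sum_{\mathbf a:\,a_i=a}\pi(\mathbf a\mid\sigma;s)\,Q_i^{\pi,\rho}(\sigma;s,\mathbf a).$$ The inducible value set is $\mathcal V^\star(s)=\{V^\pi(\varnothing;s):\pi\text{ is a CE}\}$. A value-set function assigns to each $s\in S$ a set $\mathcal V(s)\subseteq\mathbb R^{n+1}$; value-set functions are ordered by pointwise inclusion. Let $\Phi(\mathcal V)(s)$ be the set of all vectors $$\sum_{\mathbf a\in\mathbf A}\bar\pi(\mathbf a)\Big(\mathbf r(s,\mathbf a)+\gamma\,\mathbb E_{s'\sim p(\cdot\mid s,\mathbf a)}\mathbf w(\mathbf a,\mathbf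 a;s')\Big)$$ where $\bar\pi\in\Delta(\mathbf A)$ and $\mathbf w:\mathbf A^2\times S\to\mathbb R^{n+1}$ satisfy $\mathbf w(\mathbf a,\mathbf b;s')\in\mathcal V(s')$ for all $\mathbf a,\mathbf b,s'$ and, for every agent $i\in\{1,\dots,n\}$ and all $a,b\in A$, $$\sum_{\mathbf a:\,a_i=a}\bar\pi(\mathbf a)\Big(r_i(s,\mathbf a)+\gamma\,\mathbb E_{s'\sim p(\cdot\mid s,\mathbf a)}w_i(\mathbf a,\mathbf a;s')\Big)\ \ge\ \sum_{\mathbf a:\,a_i=a}\bar\pi(\mathbf a)\Big(r_i(s,\mathbf a\oplus_i b)+\gamma\,\mathbb E_{s'\sim p(\cdot\mid s,\mathbf a\oplus_i b)}w_i(\mathbf a,\mathbf a\oplus_i b;s')\Big).$$ Let $\mathcal V^0(s)=\mathcal B=[-\frac12,\frac12]^{n+1}$ for all $s\in S$ and $\mathcal V^{k+1}=\Phi(\mathcal V^k)$ for $k\in\mathbb N$. Then $\mathcal V^k\to\mathcal V^\star$ pointwise: for all $s\in S$, $\mathbf v\in\mathcal V^\star(s)$ and $\mathbf v'\notin\mathcal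 V^\star(s)$ there is $k_0\in\mathbb N$ such that $\mathbf v\in\mathcal V^k(s)$ and $\mathbf v'\notin\mathcal V^k(s)$ for all $k\ge k_0$. Moreover, for every $s\in S$, $\mathcal V^\star(s)=\bigcap_{k=1}^\infty\mathcal V^k(s)\neq\emptyset$. Finally, $\mathcal V^\star$ is the greatest fixed point of $\Phi$ among the value-set functions with bounded values: each $\mathcal V^\star(s)$ is bounded, $\Phi(\mathcal V^\star)=\mathcal V^\star$, and every value-set function $\mathcal V$ with all $\mathcal V(s)$ bounded and $\Phi(\mathcal V)=\mathcal V$ satisfies $\mathcal V(s)\subseteq\mathcal V^\star(s)$ for all $s\in S$. -/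

import Mathlib

open Finset

/-- Joint actions: one action for the principal (player `0`) and one for each of the `n` agents
(players `1, …, n`). -/
abbrev JointAction (n : ℕ) (A : Type*) : Type _ := Fin (n + 1) → A

/-- A discounted stochastic game with a principal and `n` agents. `trans s a s'` is `p(s' | s, a)`
and `reward s a i` is `r_i(s, a)`; rewards are normalized to `[-(1-γ)/2, (1-γ)/2]`. -/
structure StochasticGame (n : ℕ) (S A : Type*) [Fintype S] where
  init : S
  trans : S → JointAction n A → S → ℝ
  trans_mem : ∀ s a, trans s a ∈ stdSimplex ℝ S
  reward : S → JointAction n A → Fin (n + 1) → ℝ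
  γ : ℝ
  γ_nonneg : 0 ≤ γ
  γ_lt_one : γ < 1
  reward_mem : ∀ s a i, reward s a i ∈ Set.Icc (-((1 - γ) / 2)) ((1 - γ) / 2)

/-- Interaction histories in chronological order; an entry `(s, a, b)` records the state, the
recommended joint action and the joint action that was performed. -/
abbrev History (n : ℕ) (S A : Type*) : Type _ := List (S × JointAction n A × JointAction n A)

/-- A history-dependent correlation policy; `prob σ s a` is `π(a | σ; s)`. -/
structure CorrelationPolicy (n : ℕ) (S A : Type*) [Fintype A] where
  prob : History n S A → S → JointAction n A → ℝ
  prob_mem : ∀ σ s, prob σ s ∈ stdSimplex ℝ (JointAction n A)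

/-- A deviation plan of one agent. -/
abbrev DeviationPlan (n : ℕ) (S A : Type*) : Type _ := History n S A → S → A → A

/-- A rule giving the joint action performed, from the history, the state and the joint action
recommended. -/
abbrev PlayRule (n : ℕ) (S A : Type*) : Type _ :=
  History n S A → S → JointAction n A → JointAction n A

/-- Every player performs the recommended action. -/
def PlayRule.obey {n : ℕ} {S A : Type*} : PlayRule n S A := fun _ _ a => a

/-- Agent `i` follows the deviation plan `ρ`, all other players perform the recommended action. -/
def DeviationPlan.rule {n : ℕ} {S A : Type*} (ρ : DeviationPlan n S A) (i : Fin n) :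
    PlayRule n S A :=
  fun σ s a => Function.update a i.succ (ρ σ s (a i.succ))

/-- The trivial deviation plan is the same as obeying. -/
theorem DeviationPlan.rule_trivial {n : ℕ} {S A : Type*} (i : Fin n) :
    DeviationPlan.rule (fun (_ : History n S A) (_ : S) (x : A) => x) i = PlayRule.obey := by
  funext σ s a
  simp [DeviationPlan.rule, PlayRule.obey]

namespace StochasticGame

variable {n : ℕ} {S A : Type*} [Fintype S] [Fintype A]

/-- The expected reward of player `j` at the `t`-th time step after the present one (`t = 0` is the
present step), conditioned on the history `σ` and the present state `s`, when joint actions are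
recommended according to `π` and performed according to `d`. -/
def expReward (G : StochasticGame n S A) (π : CorrelationPolicy n S A) (d : PlayRule n S A)
    (j : Fin (n + 1)) : ℕ → History n S A → S → ℝ
  | 0, σ, s => ∑ a, π.prob σ s a * G.reward s (d σ s a) j
  | t + 1, σ, s => ∑ a, π.prob σ s a *
      ∑ s', G.trans s (d σ s a) s' * G.expReward π d j t (σ ++ [(s, a, d σ s a)]) s'

/-- The V-value: expected discounted sum of the rewards from the present step on. The series
converges, see `summable_value`. -/
noncomputable def value (G : StochasticGame n S A) (π : CorrelationPolicy n S A)
    (d : PlayRule n S A) (σ : History n S A) (s : S) : Fin (n + 1) → ℝ :=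
  fun j => ∑' t : ℕ, G.γ ^ t * G.expReward π d j t σ s

/-- The Q-value. -/
noncomputable def qValue (G : StochasticGame n S A) (π : CorrelationPolicy n S A)
    (d : PlayRule n S A) (σ : History n S A) (s : S) (a : JointAction n A) : Fin (n + 1) → ℝ :=
  fun j => G.reward s (d σ s a) j +
    G.γ * ∑ s', G.trans s (d σ s a) s' * G.value π d (σ ++ [(s, a, d σ s a)]) s' j

theorem abs_avg_le {X : Type*} [Fintype X] {q : X → ℝ} (hq : q ∈ stdSimplex ℝ X) {f : X → ℝ}
    {c : ℝ} (hf : ∀ x, |f x| ≤ c) : |∑ x, q x * f x| ≤ c := by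
  calc |∑ x, q x * f x| ≤ ∑ x, |q x * f x| := Finset.abs_sum_le_sum_abs _ _
    _ ≤ ∑ x, q x * c := by
        refine Finset.sum_le_sum fun x _ => ?_
        rw [abs_mul, abs_of_nonneg (hq.1 x)]
        exact mul_le_mul_of_nonneg_left (hf x) (hq.1 x)
    _ = c := by rw [← Finset.sum_mul, hq.2, one_mul]

theorem abs_expReward_le (G : StochasticGame n S A) (π : CorrelationPolicy n S A)
    (d : PlayRule n S A) (j : Fin (n + 1)) (t : ℕ) (σ : History n S A) (s : S) :
    |G.expReward π d j t σ s| ≤ (1 - G.γ) / 2 := by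
  induction t generalizing σ s with
  | zero => exact abs_avg_le (π.prob_mem σ s) fun a => abs_le.2 (G.reward_mem s _ j)
  | succ t ih =>
    exact abs_avg_le (π.prob_mem σ s) fun a => abs_avg_le (G.trans_mem s _) fun s' => ih _ s'

/-- The series defining the V-value converges. -/
theorem summable_value (G : StochasticGame n S A) (π : CorrelationPolicy n S A)
    (d : PlayRule n S A) (j : Fin (n + 1)) (σ : History n S A) (s : S) :
    Summable fun t : ℕ => G.γ ^ t * G.expReward π d j t σ s := by
  refine Summable.of_norm_bounded
    (g := fun t : ℕ => G.γ ^ t * ((1 - G.γ) / 2)) ?_ fun t => ?_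
  · exact (summable_geometric_of_lt_one G.γ_nonneg G.γ_lt_one).mul_right _
  · rw [Real.norm_eq_abs, abs_mul, abs_of_nonneg (pow_nonneg G.γ_nonneg t)]
    exact mul_le_mul_of_nonneg_left (G.abs_expReward_le π d j t σ s) (pow_nonneg G.γ_nonneg t)

/-- The V-value is the expectation of the Q-value over the recommended joint action. -/
theorem value_eq (G : StochasticGame n S A) (π : CorrelationPolicy n S A) (d : PlayRule n S A)
    (σ : History n S A) (s : S) (j : Fin (n + 1)) :
    G.value π d σ s j = ∑ a, π.prob σ s a * G.qValue π d σ s a j := by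
  have key : ∀ t : ℕ, G.γ ^ (t + 1) * G.expReward π d j (t + 1) σ s =
      ∑ a, ∑ s', π.prob σ s a * G.γ * G.trans s (d σ s a) s' *
        (G.γ ^ t * G.expReward π d j t (σ ++ [(s, a, d σ s a)]) s') := by
    intro t
    rw [expReward, Finset.mul_sum]
    refine Finset.sum_congr rfl fun a _ => ?_
    rw [Finset.mul_sum, Finset.mul_sum]
    exact Finset.sum_congr rfl fun s' _ => by ring
  have hs := fun a s' => G.summable_value π d j (σ ++ [(s, a, d σ s a)]) s'
  rw [value, (G.summable_value π d j σ s).tsum_eq_zero_add]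
  simp only [key]
  rw [Summable.tsum_finsetSum fun a _ => summable_sum fun s' _ => (hs a s').mul_left _]
  simp only [qValue, mul_add, Finset.sum_add_distrib]
  congr 1
  · simp [expReward]
  · refine Finset.sum_congr rfl fun a _ => ?_
    rw [Summable.tsum_finsetSum fun s' _ => (hs a s').mul_left _, Finset.mul_sum, Finset.mul_sum]
    refine Finset.sum_congr rfl fun s' _ => ?_
    rw [tsum_mul_left, value]
    ring

variable [DecidableEq A]

/-- `π` forms a `δ`-correlated equilibrium: after every history, at every state and for every
recommendation `x`, no deviation plan of any agent gains more than `δ`. -/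
def IsDeltaCE (G : StochasticGame n S A) (δ : ℝ) (π : CorrelationPolicy n S A) : Prop :=
  ∀ (i : Fin n) (σ : History n S A) (s : S) (x : A) (ρ : DeviationPlan n S A),
    ∑ a with a i.succ = x, π.prob σ s a * G.qValue π (ρ.rule i) σ s a i.succ - δ ≤
      ∑ a with a i.succ = x, π.prob σ s a * G.qValue π PlayRule.obey σ s a i.succ

/-- The inducible value sets: all values induced at `s` by correlated equilibria. -/
def inducibleSet (G : StochasticGame n S A) (s : S) : Set (Fin (n + 1) → ℝ) :=
  {v | ∃ π : CorrelationPolicy n S A, G.IsDeltaCE 0 π ∧ v = G.value π PlayRule.obey [] s}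

/-- `Bellman(s, q, w)`. -/
def bellman (G : StochasticGame n S A) (s : S) (q : JointAction n A → ℝ)
    (w : JointAction n A → JointAction n A → S → Fin (n + 1) → ℝ) : Fin (n + 1) → ℝ :=
  fun j => ∑ a, q a * (G.reward s a j + G.γ * ∑ s', G.trans s a s' * w a a s' j)

/-- The incentive constraint on a one-step action distribution `q` and onward values `w`, where
`w a b s'` is the onward value at `s'` after `a` was recommended and `b` performed. -/
def SatisfiesIC (G : StochasticGame n S A) (s : S) (q : JointAction n A → ℝ)
    (w : JointAction n A → JointAction n A → S → Fin (n + 1) → ℝ) : Prop :=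
  ∀ (i : Fin n) (x y : A),
    ∑ a with a i.succ = x, q a * (G.reward s (Function.update a i.succ y) i.succ +
        G.γ * ∑ s', G.trans s (Function.update a i.succ y) s' *
          w a (Function.update a i.succ y) s' i.succ) ≤
      ∑ a with a i.succ = x, q a * (G.reward s a i.succ +
        G.γ * ∑ s', G.trans s a s' * w a a s' i.succ)

/-- The exact update map `Φ` on value-set functions. -/
def Phi (G : StochasticGame n S A) (V : S → Set (Fin (n + 1) → ℝ)) :
    S → Set (Fin (n + 1) → ℝ) :=
  fun s => {v | ∃ (q : JointAction n A → ℝ)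
    (w : JointAction n A → JointAction n A → S → Fin (n + 1) → ℝ),
    q ∈ stdSimplex ℝ (JointAction n A) ∧ G.SatisfiesIC s q w ∧
      (∀ a b s', w a b s' ∈ V s') ∧ v = G.bellman s q w}

end StochasticGame

/-- The value-set function that is constantly the hypercube `[-1/2, 1/2]^(n+1)`. -/
def hypercube (n : ℕ) (S : Type*) : S → Set (Fin (n + 1) → ℝ) :=
  fun _ => {v | ∀ j, v j ∈ Set.Icc (-(1 / 2) : ℝ) (1 / 2)}

/-!
Write `I` for the inducible value sets, `Φ` for `G.Phi` and `V k` for the iterates of `Φ` from the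
hypercube.

By the one-shot deviation principle (`isDeltaCE_zero_iff_satisfiesIC`), a policy is a correlated
equilibrium iff after every history the distribution it uses and its own onward values satisfy the
one-step incentive constraint. Since continuations of equilibria are equilibria, this gives
`I ≤ Φ I`. Conversely, any bounded `W` with `W ≤ Φ W` lies below `I`: a policy that remembers the
promised values and keeps realising them by onward promises from `W` has exactly the promised
values, by discounting, and is an equilibrium (`le_inducibleSet_of_le_Phi`). Applied to `I` and
`Φ I`, this makes `I` the greatest bounded fixed point.

As `Φ` is monotone and maps the hypercube into itself, the `V k` decrease and contain `I`. Each `V k`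
is compact, being the image of a compact set of one-step data, so `Φ` commutes with the intersection
of the `V k` (`iInter_Phi_subset`). The intersection is thus self-generating and equals `I`.

The intersection is nonempty because every `V k` is: with onward values that do not depend on the
actions, `Φ` asks for a correlated equilibrium of a finite one-shot game, which exists by the
argument of Hart and Schmeidler (`exists_correlated_equilibrium`).
-/

/-! ### Correlated equilibria of one-shot games -/

/-- A finite Markov chain with jump rates `r x y` has an invariant distribution. The balance
equations have a nonzero solution because they sum to zero; taking absolute values preserves each
of them up to an inequality, and the inequalities sum to an equality. -/
theorem exists_balanced_distribution {A : Type*} [Fintype A] [Nonempty A]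
    (r : A → A → ℝ) (hr : ∀ x y, 0 ≤ r x y) :
    ∃ μ ∈ stdSimplex ℝ A, ∀ x, ∑ y, μ y * r y x = μ x * ∑ y, r x y := by
  classical
  let L : Matrix A A ℝ := Matrix.of fun y x => r y x - if y = x then ∑ z, r x z else 0
  have hL : ∀ (ν : A → ℝ) x, Matrix.vecMul ν L x = ∑ y, ν y * r y x - ν x * ∑ y, r x y := by
    intro ν x
    simp [L, Matrix.vecMul, dotProduct, mul_sub, Finset.sum_sub_distrib]
  have hdet : L.det = 0 := by
    refine Matrix.exists_mulVec_eq_zero_iff.1 ⟨fun _ => 1, ?_, ?_⟩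
    · obtain ⟨x⟩ := ‹Nonempty A›
      exact fun h => one_ne_zero (congrFun h x)
    · funext y
      simp [L, Matrix.mulVec, dotProduct, Finset.sum_sub_distrib]
  obtain ⟨ν, hν0, hν⟩ := Matrix.exists_vecMul_eq_zero_iff.2 hdet
  have hbal : ∀ x, ∑ y, ν y * r y x = ν x * ∑ y, r x y := fun x => by
    have := congrFun hν x
    rw [hL] at this
    exact sub_eq_zero.1 this
  have hle : ∀ x ∈ (univ : Finset A), |ν x| * ∑ y, r x y ≤ ∑ y, |ν y| * r y x := fun x _ => by
    calc |ν x| * ∑ y, r x y = |∑ y, ν y * r y x| := by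
          rw [hbal, abs_mul, abs_of_nonneg (Finset.sum_nonneg fun y _ => hr x y)]
      _ ≤ ∑ y, |ν y * r y x| := Finset.abs_sum_le_sum_abs _ _
      _ = ∑ y, |ν y| * r y x :=
          Finset.sum_congr rfl fun y _ => by rw [abs_mul, abs_of_nonneg (hr y x)]
  have hsum : ∑ x, |ν x| * ∑ y, r x y = ∑ x, ∑ y, |ν y| * r y x := by
    rw [Finset.sum_comm]
    exact Finset.sum_congr rfl fun x _ => Finset.mul_sum _ _ _
  have heq := (Finset.sum_eq_sum_iff_of_le hle).1 hsum
  have hpos : 0 < ∑ x, |ν x| := by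
    obtain ⟨x, hx⟩ := Function.ne_iff.1 hν0
    exact Finset.sum_pos' (fun _ _ => abs_nonneg _) ⟨x, mem_univ x, abs_pos.2 hx⟩
  refine ⟨fun x => |ν x| / ∑ z, |ν z|, ⟨fun x => by positivity, ?_⟩, fun x => ?_⟩
  · rw [← Finset.sum_div, div_self hpos.ne']
  · have := heq x (mem_univ x)
    simp only [div_mul_eq_mul_div, ← Finset.sum_div, this]

/-- If player `i` draws the own action from a distribution balanced for the rates `r`, independently
of the others, then switching at rates `r` does not change the expected payoff. -/
theorem sum_prod_mul_switch_eq {I A : Type*} [Fintype I] [DecidableEq I] [Fintype A]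
    (μ : I → A → ℝ) (i : I) (r : A → A → ℝ)
    (hbal : ∀ x, ∑ y, μ i y * r y x = μ i x * ∑ y, r x y) (u : (I → A) → ℝ) :
    ∑ a : I → A, ∑ y, (∏ j, μ j (a j)) * r (a i) y * u (Function.update a i y) =
      ∑ a : I → A, ∑ y, (∏ j, μ j (a j)) * r (a i) y * u a := by
  have hsplit : ∀ a : I → A, ∏ j, μ j (a j) = μ i (a i) * ∏ j ∈ univ.erase i, μ j (a j) :=
    fun a => (Finset.mul_prod_erase _ _ (mem_univ i)).symm
  -- Exchanging the action of player `i` with the action switched to is an involution.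
  have hswap : Function.Involutive
      fun p : (I → A) × A => (Function.update p.1 i p.2, p.1 i) := fun p => by simp
  rw [← Fintype.sum_prod_type', ← Equiv.sum_comp hswap.toPerm, Fintype.sum_prod_type]
  refine Finset.sum_congr rfl fun a _ => ?_
  have hrest : ∀ y, ∏ j ∈ univ.erase i, μ j (Function.update a i y j) =
      ∏ j ∈ univ.erase i, μ j (a j) := fun y =>
    Finset.prod_congr rfl fun j hj => by rw [Function.update_of_ne (Finset.ne_of_mem_erase hj)]
  calc _ = ∑ y, (∏ j ∈ univ.erase i, μ j (a j)) * u a * (μ i y * r y (a i)) := by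
        refine Finset.sum_congr rfl fun y _ => ?_
        simp only [Function.Involutive.coe_toPerm, hsplit, hrest, Function.update_self,
          Function.update_idem, Function.update_eq_self]
        ring
    _ = ∑ y, (∏ j, μ j (a j)) * r (a i) y * u a := by
        rw [← Finset.mul_sum, hbal, hsplit, ← Finset.sum_mul, ← Finset.mul_sum]
        ring

/-- Every finite game has a correlated equilibrium. If none existed, a hyperplane would separate the
attainable vectors of incentive slacks from the nonnegative orthant; its normal vector consists of
switching rates for which a product of balanced distributions has weighted total slack zero. -/
theorem exists_correlated_equilibrium {I A : Type*} [Fintype I] [DecidableEq I] [Fintype A]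
    [DecidableEq A] [Nonempty A] (u : I → (I → A) → ℝ) :
    ∃ q ∈ stdSimplex ℝ (I → A), ∀ i x y,
      ∑ a with a i = x, q a * u i (Function.update a i y) ≤ ∑ a with a i = x, q a * u i a := by
  by_contra! hno
  let T : ((I → A) → ℝ) →ₗ[ℝ] (I × A × A → ℝ) :=
    { toFun := fun q k => ∑ a with a k.1 = k.2.1,
        q a * (u k.1 a - u k.1 (Function.update a k.1 k.2.2))
      map_add' := fun q q' => by
        funext k
        simp [add_mul, Finset.sum_add_distrib]
      map_smul' := fun c q => by
        funext k
        simp [Finset.mul_sum, mul_assoc] }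
  have hT : ∀ q k, T q k = ∑ a with a k.1 = k.2.1,
      q a * (u k.1 a - u k.1 (Function.update a k.1 k.2.2)) := fun _ _ => rfl
  have hdisj : Disjoint (T '' stdSimplex ℝ (I → A)) (Set.Ici 0) := by
    rw [Set.disjoint_left]
    rintro _ ⟨q, hq, rfl⟩ hpos
    obtain ⟨i, x, y, hlt⟩ := hno q hq
    have := hpos (i, x, y)
    rw [hT] at this
    simp only [mul_sub, Finset.sum_sub_distrib, Pi.zero_apply] at this
    linarith
  obtain ⟨f, c, d, hfc, hcd, hd⟩ := geometric_hahn_banach_compact_closed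
    ((convex_stdSimplex ℝ (I → A)).linear_image T)
    ((isCompact_stdSimplex ℝ (I → A)).image T.continuous_of_finiteDimensional)
    (convex_Ici 0) isClosed_Ici hdisj
  have hd0 : d < 0 := by simpa using hd 0 Set.self_mem_Ici
  have hrate : ∀ k, 0 ≤ f (Pi.single k 1) := by
    intro k
    by_contra! hneg
    -- A large multiple of the `k`-th unit vector would leave the half-space `d < f`.
    have := hd ((d / f (Pi.single k 1)) • Pi.single k 1) <| Set.mem_Ici.2 <|
      smul_nonneg (div_nonneg_of_nonpos hd0.le hneg.le) (Pi.single_nonneg.2 zero_le_one)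
    rw [map_smul, smul_eq_mul, div_mul_cancel₀ _ hneg.ne] at this
    exact lt_irrefl _ this
  choose μ hμ hbal using fun i =>
    exists_balanced_distribution (fun x y => f (Pi.single (i, x, y) 1)) fun x y => hrate _
  let q : (I → A) → ℝ := fun a => ∏ j, μ j (a j)
  have hq : q ∈ stdSimplex ℝ (I → A) :=
    ⟨fun a => Finset.prod_nonneg fun j _ => (hμ j).1 _, by
      rw [← Fintype.prod_sum]
      exact Finset.prod_eq_one fun j _ => (hμ j).2⟩
  have hf : f (T q) = ∑ k, T q k * f (Pi.single k 1) := by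
    conv_lhs => rw [pi_eq_sum_univ' (T q)]
    simp [map_sum]
  have hzero : f (T q) = 0 := by
    rw [hf, Fintype.sum_prod_type]
    refine Finset.sum_eq_zero fun i _ => ?_
    have key := sum_prod_mul_switch_eq μ i (fun x y => f (Pi.single (i, x, y) 1)) (hbal i) (u i)
    calc ∑ k : A × A, T q (i, k) * f (Pi.single (i, k) 1)
        = ∑ y, ∑ x, ∑ a with a i = x, q a * f (Pi.single (i, a i, y) 1) *
            (u i a - u i (Function.update a i y)) := by
          rw [Fintype.sum_prod_type, Finset.sum_comm]
          refine Finset.sum_congr rfl fun y _ => Finset.sum_congr rfl fun x _ => ?_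
          rw [hT, Finset.sum_mul]
          refine Finset.sum_congr rfl fun a ha => ?_
          rw [(Finset.mem_filter.1 ha).2]
          ring
      _ = 0 := by
          simp only [Finset.sum_fiberwise]
          rw [Finset.sum_comm]
          simp only [mul_sub, Finset.sum_sub_distrib]
          rw [key, sub_self]
  have := hfc _ ⟨q, hq, rfl⟩
  linarith

/-! ### The hypercube -/

theorem isCompact_hypercube {n : ℕ} {S : Type*} (s : S) : IsCompact (hypercube n S s) := by
  have : hypercube n S s = Set.univ.pi fun _ => Set.Icc (-(1 / 2)) (1 / 2) := by
    ext v
    simp only [hypercube, Set.mem_ofPred_eq, Set.mem_univ_pi]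
  rw [this]
  exact isCompact_univ_pi fun _ => isCompact_Icc

namespace StochasticGame

variable {n : ℕ} {S A : Type*} [Fintype S]

/-! ### Values of policies -/

/-- The payoff vector of performing the joint action `b` at the state `s` when the onward values are
`u`. `qValue` and the terms of `bellman` and `SatisfiesIC` have this form by definition. -/
def lookahead (G : StochasticGame n S A) (s : S) (b : JointAction n A)
    (u : S → Fin (n + 1) → ℝ) : Fin (n + 1) → ℝ :=
  fun j => G.reward s b j + G.γ * ∑ s', G.trans s b s' * u s' j

theorem lookahead_le (G : StochasticGame n S A) {s : S} {b : JointAction n A}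
    {u u' : S → Fin (n + 1) → ℝ} {j : Fin (n + 1)} {c : ℝ} (h : ∀ s', u s' j ≤ u' s' j + c) :
    G.lookahead s b u j ≤ G.lookahead s b u' j + G.γ * c := by
  have : ∑ s', G.trans s b s' * u s' j ≤ ∑ s', G.trans s b s' * u' s' j + c := by
    calc _ ≤ ∑ s', G.trans s b s' * (u' s' j + c) :=
          Finset.sum_le_sum fun s' _ => mul_le_mul_of_nonneg_left (h s') ((G.trans_mem s b).1 s')
      _ = _ := by
          simp only [mul_add, Finset.sum_add_distrib, ← Finset.sum_mul, (G.trans_mem s b).2,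
            one_mul]
  have := mul_le_mul_of_nonneg_left this G.γ_nonneg
  simp only [lookahead]
  linarith

theorem abs_lookahead_le (G : StochasticGame n S A) {s : S} {b : JointAction n A}
    {u : S → Fin (n + 1) → ℝ} {j : Fin (n + 1)} (h : ∀ s', |u s' j| ≤ 1 / 2) :
    |G.lookahead s b u j| ≤ 1 / 2 := by
  have h1 := abs_le.1 (abs_avg_le (G.trans_mem s b) h)
  have h2 := G.reward_mem s b j
  have h3 := mul_le_mul_of_nonneg_left h1.1 G.γ_nonneg
  have h4 := mul_le_mul_of_nonneg_left h1.2 G.γ_nonneg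
  rw [lookahead, abs_le]
  constructor <;> linarith [h2.1, h2.2]

/-- A function bounded above is nonpositive as soon as each of its upper bounds may be multiplied by
the discount factor. -/
theorem nonpos_of_forall_le_mul (G : StochasticGame n S A) {X : Type*} {f : X → ℝ} {c : ℝ}
    (hf : ∀ x, f x ≤ c) (h : ∀ c, (∀ x, f x ≤ c) → ∀ x, f x ≤ G.γ * c) (x : X) : f x ≤ 0 := by
  have hpow : ∀ k x, f x ≤ G.γ ^ k * c := by
    intro k
    induction k with
    | zero => simpa using hf
    | succ k ih => simpa only [pow_succ', mul_assoc] using h _ ih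
  have hlim := (tendsto_pow_atTop_nhds_zero_of_lt_one G.γ_nonneg G.γ_lt_one).mul_const c
  rw [zero_mul] at hlim
  exact ge_of_tendsto' hlim fun k => hpow k x

variable [Fintype A]

theorem abs_value_le (G : StochasticGame n S A) (π : CorrelationPolicy n S A)
    (d : PlayRule n S A) (σ : History n S A) (s : S) (j : Fin (n + 1)) :
    |G.value π d σ s j| ≤ 1 / 2 := by
  have hg := (hasSum_geometric_of_lt_one G.γ_nonneg G.γ_lt_one).mul_right ((1 - G.γ) / 2)
  have := tsum_of_norm_bounded hg (f := fun t => G.γ ^ t * G.expReward π d j t σ s) fun t => by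
    rw [Real.norm_eq_abs, abs_mul, abs_of_nonneg (pow_nonneg G.γ_nonneg t)]
    exact mul_le_mul_of_nonneg_left (G.abs_expReward_le π d j t σ s) (pow_nonneg G.γ_nonneg t)
  have hne : 1 - G.γ ≠ 0 := (sub_pos.2 G.γ_lt_one).ne'
  calc _ ≤ (1 - G.γ)⁻¹ * ((1 - G.γ) / 2) := this
    _ = 1 / 2 := by field_simp

/-- Bounded promises that are kept in expectation after every history are the values. -/
theorem value_obey_eq_of_promises (G : StochasticGame n S A) (π : CorrelationPolicy n S A)
    (T : History n S A → S → Fin (n + 1) → ℝ) {c : ℝ} (hc : ∀ σ s j, |T σ s j| ≤ c)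
    (hT : ∀ σ s j, T σ s j =
      ∑ a, π.prob σ s a * G.lookahead s a (T (σ ++ [(s, a, a)])) j) :
    G.value π PlayRule.obey = T := by
  have key : ∀ T₁ T₂ : History n S A → S → Fin (n + 1) → ℝ,
      (∀ σ s j, T₁ σ s j = ∑ a, π.prob σ s a * G.lookahead s a (T₁ (σ ++ [(s, a, a)])) j) →
      (∀ σ s j, T₂ σ s j = ∑ a, π.prob σ s a * G.lookahead s a (T₂ (σ ++ [(s, a, a)])) j) →
      (∃ C, ∀ σ s j, T₁ σ s j - T₂ σ s j ≤ C) → ∀ σ s j, T₁ σ s j ≤ T₂ σ s j := by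
    rintro T₁ T₂ h₁ h₂ ⟨C, hC⟩ σ s j
    refine sub_nonpos.1 (G.nonpos_of_forall_le_mul (X := History n S A × S)
      (f := fun x => T₁ x.1 x.2 j - T₂ x.1 x.2 j) (fun x => hC _ _ _) ?_ (σ, s))
    rintro e he ⟨σ, s⟩
    have hle : ∀ a, G.lookahead s a (T₁ (σ ++ [(s, a, a)])) j ≤
        G.lookahead s a (T₂ (σ ++ [(s, a, a)])) j + G.γ * e := fun a =>
      G.lookahead_le fun s' => by linarith [he (σ ++ [(s, a, a)], s')]
    have := Finset.sum_le_sum fun a (_ : a ∈ univ) =>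
      mul_le_mul_of_nonneg_left (hle a) ((π.prob_mem σ s).1 a)
    simp only [mul_add, Finset.sum_add_distrib, ← Finset.sum_mul, (π.prob_mem σ s).2,
      one_mul] at this
    simp only
    rw [h₁, h₂]
    linarith
  have hV := fun σ s j => G.value_eq π PlayRule.obey σ s j
  have hbd := G.abs_value_le π PlayRule.obey
  funext σ s j
  refine le_antisymm (key _ _ hV hT ⟨1 / 2 + c, fun σ s j => ?_⟩ σ s j)
    (key _ _ hT hV ⟨1 / 2 + c, fun σ s j => ?_⟩ σ s j) <;>
  linarith [(abs_le.1 (hbd σ s j)).1, (abs_le.1 (hbd σ s j)).2, (abs_le.1 (hc σ s j)).1,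
    (abs_le.1 (hc σ s j)).2]

end StochasticGame

/-- The policy that continues `π` after the history `τ`. -/
def CorrelationPolicy.after {n : ℕ} {S A : Type*} [Fintype A] (π : CorrelationPolicy n S A)
    (τ : History n S A) : CorrelationPolicy n S A where
  prob σ := π.prob (τ ++ σ)
  prob_mem σ := π.prob_mem (τ ++ σ)

namespace StochasticGame

variable {n : ℕ} {S A : Type*} [Fintype S] [Fintype A]

theorem expReward_after (G : StochasticGame n S A) (π : CorrelationPolicy n S A)
    (d : PlayRule n S A) (τ : History n S A) (j : Fin (n + 1)) (t : ℕ) (σ : History n S A) (s : S) :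
    G.expReward (π.after τ) (fun σ => d (τ ++ σ)) j t σ s = G.expReward π d j t (τ ++ σ) s := by
  induction t generalizing σ s with
  | zero => rfl
  | succ t ih =>
    simp only [expReward, ih, List.append_assoc]
    rfl

theorem value_after (G : StochasticGame n S A) (π : CorrelationPolicy n S A)
    (d : PlayRule n S A) (τ σ : History n S A) (s : S) :
    G.value (π.after τ) (fun σ => d (τ ++ σ)) σ s = G.value π d (τ ++ σ) s := by
  funext j
  simp only [value, expReward_after]

theorem value_congr_after (G : StochasticGame n S A) (π : CorrelationPolicy n S A)
    {d d' : PlayRule n S A} {τ : History n S A} (h : ∀ σ, d (τ ++ σ) = d' (τ ++ σ)) (s : S) :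
    G.value π d τ s = G.value π d' τ s := by
  have h1 := G.value_after π d τ [] s
  have h2 := G.value_after π d' τ [] s
  simp only [h, List.append_nil] at h1 h2
  exact h1.symm.trans h2

theorem continuous_bellman (G : StochasticGame n S A) (s : S) :
    Continuous fun p : (JointAction n A → ℝ) ×
      (JointAction n A → JointAction n A → S → Fin (n + 1) → ℝ) => G.bellman s p.1 p.2 := by
  unfold bellman
  fun_prop

/-! ### The one-shot deviation principle -/

variable [DecidableEq A]

/-- A policy is a correlated equilibrium iff after every history no agent gains from deviating in
the present step only. -/
theorem isDeltaCE_zero_iff_satisfiesIC (G : StochasticGame n S A) (π : CorrelationPolicy n S A) :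
    G.IsDeltaCE 0 π ↔ ∀ σ s, G.SatisfiesIC s (π.prob σ s)
      fun a b => G.value π PlayRule.obey (σ ++ [(s, a, b)]) := by
  constructor
  · classical
    intro h σ s i x y
    let ρ : DeviationPlan n S A := fun σ' _ z => if σ' = σ then y else z
    have hρ : ∀ a, a i.succ = x → G.qValue π (ρ.rule i) σ s a i.succ =
        G.lookahead s (Function.update a i.succ y)
          (G.value π PlayRule.obey (σ ++ [(s, a, Function.update a i.succ y)])) i.succ := by
      intro a _
      have hd : ρ.rule i σ s a = Function.update a i.succ y := by
        simp [DeviationPlan.rule, ρ]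
      have hobey : ∀ e σ', ρ.rule i (σ ++ [e] ++ σ') = PlayRule.obey (σ ++ [e] ++ σ') := by
        intro e σ'
        have hne : σ ++ [e] ++ σ' ≠ σ := fun h => by simpa using congrArg List.length h
        funext s' b
        simp [DeviationPlan.rule, PlayRule.obey, ρ, -List.append_assoc, hne]
      simp only [qValue, lookahead, hd]
      congr 2
      exact Finset.sum_congr rfl fun s' _ => by rw [G.value_congr_after π (hobey _)]
    have := h i σ s x ρ
    rw [sub_zero, Finset.sum_congr rfl fun a ha => by rw [hρ a (Finset.mem_filter.1 ha).2]] at this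
    exact this
  · intro h i σ s x ρ
    -- If deviating gains at most `c` over obeying anywhere, then by the one-step constraints it
    -- gains at most `γ * c` in total at any recommendation, weighted with its probability.
    have hstep : ∀ c, (∀ σ s, G.value π (ρ.rule i) σ s i.succ -
          G.value π PlayRule.obey σ s i.succ ≤ c) → ∀ σ s x,
        ∑ a with a i.succ = x, π.prob σ s a * G.qValue π (ρ.rule i) σ s a i.succ ≤
          ∑ a with a i.succ = x, π.prob σ s a * G.qValue π PlayRule.obey σ s a i.succ +
            (∑ a with a i.succ = x, π.prob σ s a) * (G.γ * c) := by
      intro c hc σ s x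
      have hle : ∀ a ∈ univ.filter fun a : JointAction n A => a i.succ = x,
          π.prob σ s a * G.qValue π (ρ.rule i) σ s a i.succ ≤
          π.prob σ s a * G.lookahead s (Function.update a i.succ (ρ σ s x))
            (G.value π PlayRule.obey (σ ++ [(s, a, Function.update a i.succ (ρ σ s x))])) i.succ +
              π.prob σ s a * (G.γ * c) := by
        intro a ha
        rw [← mul_add]
        refine mul_le_mul_of_nonneg_left ?_ ((π.prob_mem σ s).1 a)
        rw [← (Finset.mem_filter.1 ha).2]
        exact G.lookahead_le fun s' =>
          sub_le_iff_le_add'.1 (hc (σ ++ [(s, a, ρ.rule i σ s a)]) s')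
      have h1 := Finset.sum_le_sum hle
      rw [Finset.sum_add_distrib, ← Finset.sum_mul] at h1
      exact h1.trans (add_le_add_left (h σ s i x (ρ σ s x)) _)
    have hval : ∀ σ s, G.value π (ρ.rule i) σ s i.succ ≤ G.value π PlayRule.obey σ s i.succ := by
      intro σ s
      refine sub_nonpos.1 (G.nonpos_of_forall_le_mul (X := History n S A × S) (c := 1)
        (f := fun z => G.value π (ρ.rule i) z.1 z.2 i.succ -
          G.value π PlayRule.obey z.1 z.2 i.succ) (fun z => ?_) ?_ (σ, s))
      · linarith [(abs_le.1 (G.abs_value_le π (ρ.rule i) z.1 z.2 i.succ)).2,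
          (abs_le.1 (G.abs_value_le π PlayRule.obey z.1 z.2 i.succ)).1]
      · rintro c hc ⟨σ, s⟩
        have h1 := Finset.sum_le_sum fun x (_ : x ∈ univ) => hstep c (fun σ s => hc (σ, s)) σ s x
        rw [Finset.sum_add_distrib, ← Finset.sum_mul] at h1
        simp only [Finset.sum_fiberwise, (π.prob_mem σ s).2, one_mul, ← G.value_eq] at h1
        simp only
        linarith
    have := hstep 0 (fun σ s => by linarith [hval σ s]) σ s x
    linarith

theorem IsDeltaCE.after {G : StochasticGame n S A} {π : CorrelationPolicy n S A}
    (h : G.IsDeltaCE 0 π) (τ : History n S A) : G.IsDeltaCE 0 (π.after τ) := by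
  rw [isDeltaCE_zero_iff_satisfiesIC] at h ⊢
  intro σ s
  have hv : ∀ a b, G.value (π.after τ) PlayRule.obey (σ ++ [(s, a, b)]) =
      G.value π PlayRule.obey (τ ++ σ ++ [(s, a, b)]) := fun a b => by
    rw [List.append_assoc]
    exact funext (G.value_after π PlayRule.obey τ _)
  simp only [hv]
  exact h (τ ++ σ) s

/-! ### Self-generation -/

theorem Phi_mono (G : StochasticGame n S A) : Monotone G.Phi := by
  rintro V W hVW s _ ⟨q, w, hq, hic, hw, rfl⟩
  exact ⟨q, w, hq, hic, fun a b s' => hVW s' (hw a b s'), rfl⟩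

theorem inducibleSet_le_hypercube (G : StochasticGame n S A) :
    G.inducibleSet ≤ hypercube n S := by
  rintro s _ ⟨π, -, rfl⟩ j
  exact abs_le.1 (G.abs_value_le π _ _ s j)

theorem inducibleSet_le_Phi (G : StochasticGame n S A) :
    G.inducibleSet ≤ G.Phi G.inducibleSet := by
  rintro s _ ⟨π, hπ, rfl⟩
  refine ⟨π.prob [] s, fun a b => G.value π PlayRule.obey [(s, a, b)], π.prob_mem [] s,
    (G.isDeltaCE_zero_iff_satisfiesIC π).1 hπ [] s, fun a b s' => ?_, ?_⟩
  · exact ⟨π.after [(s, a, b)], hπ.after _, (G.value_after π PlayRule.obey [(s, a, b)] [] s').symm⟩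
  · exact funext fun j => G.value_eq π PlayRule.obey [] s j

/-- Self-generation: bounded sets of values that can be realised with onward values from the same
sets are inducible. The policy keeps track of the values promised for the next step, and after each
step replaces them by the onward values that realise the promise made for the current state. -/
theorem le_inducibleSet_of_le_Phi (G : StochasticGame n S A) {W : S → Set (Fin (n + 1) → ℝ)}
    (hb : ∀ s, Bornology.IsBounded (W s)) (hW : W ≤ G.Phi W) : W ≤ G.inducibleSet := by
  classical
  intro s₀ v₀ hv₀
  choose q w hq hic hw hv using fun (s : S) (v : W s) => hW s v.2
  -- A promise made at `s₀` leads to promises at all states, whether reachable or not.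
  have hf₀ : ∃ f : ∀ s, W s, (f s₀ : Fin (n + 1) → ℝ) = v₀ := by
    obtain ⟨a, -⟩ : ∃ a, q s₀ ⟨v₀, hv₀⟩ a ≠ 0 := by
      by_contra! h
      simpa [h] using (hq s₀ ⟨v₀, hv₀⟩).2
    exact ⟨Function.update (fun s => ⟨w s₀ ⟨v₀, hv₀⟩ a a s, hw _ _ _ _ _⟩) s₀ ⟨v₀, hv₀⟩, by simp⟩
  obtain ⟨f₀, hf₀⟩ := hf₀
  let step : (∀ s, W s) → S × JointAction n A × JointAction n A → ∀ s, W s :=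
    fun f e s' => ⟨w e.1 (f e.1) e.2.1 e.2.2 s', hw _ _ _ _ _⟩
  let F : History n S A → ∀ s, W s := fun σ => σ.foldl step f₀
  let T : History n S A → S → Fin (n + 1) → ℝ := fun σ s => F σ s
  have hT : ∀ σ s a b, T (σ ++ [(s, a, b)]) = w s (F σ s) a b := fun σ s a b => by
    simp [T, F, step]
  let π : CorrelationPolicy n S A := ⟨fun σ s => q s (F σ s), fun σ s => hq s _⟩
  have hbd : ∃ c, ∀ σ s j, |T σ s j| ≤ c := by
    obtain ⟨c, hc⟩ := (Bornology.isBounded_iUnion.2 hb).exists_norm_le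
    exact ⟨c, fun σ s j => (norm_le_pi_norm (T σ s) j).trans
      (hc _ (Set.mem_iUnion.2 ⟨s, (F σ s).2⟩))⟩
  obtain ⟨c, hc⟩ := hbd
  have hval : G.value π PlayRule.obey = T := by
    refine G.value_obey_eq_of_promises π T hc fun σ s j => ?_
    simp only [hT]
    exact congrFun (hv s (F σ s)) j
  refine ⟨π, (G.isDeltaCE_zero_iff_satisfiesIC π).2 fun σ s => ?_, ?_⟩
  · simp only [hval, hT]
    exact hic s (F σ s)
  · rw [hval]
    exact hf₀.symm

theorem isBounded_inducibleSet (G : StochasticGame n S A) (s : S) :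
    Bornology.IsBounded (G.inducibleSet s) :=
  (isCompact_hypercube s).isBounded.subset (G.inducibleSet_le_hypercube s)

theorem Phi_hypercube_le (G : StochasticGame n S A) :
    G.Phi (hypercube n S) ≤ hypercube n S := by
  rintro s _ ⟨q, w, hq, -, hw, rfl⟩ j
  exact abs_le.1 <| abs_avg_le hq fun a => G.abs_lookahead_le fun s' => abs_le.2 (hw a a s' j)

theorem Phi_inducibleSet (G : StochasticGame n S A) : G.Phi G.inducibleSet = G.inducibleSet := by
  refine le_antisymm ?_ G.inducibleSet_le_Phi
  have hle : G.Phi G.inducibleSet ≤ hypercube n S :=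
    (G.Phi_mono G.inducibleSet_le_hypercube).trans G.Phi_hypercube_le
  exact G.le_inducibleSet_of_le_Phi (fun s => (isCompact_hypercube s).isBounded.subset (hle s))
    (G.Phi_mono G.inducibleSet_le_Phi)

/-! ### Compactness and nonemptiness of the iterates -/

/-- The one-step distributions and onward values that `Phi` admits at the state `s`. -/
def feasible (G : StochasticGame n S A) (V : S → Set (Fin (n + 1) → ℝ)) (s : S) :
    Set ((JointAction n A → ℝ) × (JointAction n A → JointAction n A → S → Fin (n + 1) → ℝ)) :=
  {p | p.1 ∈ stdSimplex ℝ (JointAction n A) ∧ G.SatisfiesIC s p.1 p.2 ∧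
    ∀ a b s', p.2 a b s' ∈ V s'}

theorem Phi_eq_image (G : StochasticGame n S A) (V : S → Set (Fin (n + 1) → ℝ)) (s : S) :
    G.Phi V s = (fun p => G.bellman s p.1 p.2) '' G.feasible V s := by
  ext v
  constructor
  · rintro ⟨q, w, hq, hic, hw, rfl⟩
    exact ⟨(q, w), ⟨hq, hic, hw⟩, rfl⟩
  · rintro ⟨⟨q, w⟩, ⟨hq, hic, hw⟩, rfl⟩
    exact ⟨q, w, hq, hic, hw, rfl⟩

theorem isCompact_feasible (G : StochasticGame n S A) {V : S → Set (Fin (n + 1) → ℝ)}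
    (hV : ∀ s, IsCompact (V s)) (s : S) : IsCompact (G.feasible V s) := by
  have hprod : IsCompact (stdSimplex ℝ (JointAction n A) ×ˢ
      Set.univ.pi fun _ : JointAction n A => Set.univ.pi fun _ : JointAction n A =>
        Set.univ.pi V) :=
    (isCompact_stdSimplex ℝ _).prod <| isCompact_univ_pi fun _ => isCompact_univ_pi fun _ =>
      isCompact_univ_pi hV
  have hIC : IsClosed {p : (JointAction n A → ℝ) ×
      (JointAction n A → JointAction n A → S → Fin (n + 1) → ℝ) |
        G.SatisfiesIC s p.1 p.2} := by
    simp only [SatisfiesIC, Set.ofPred_forall]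
    exact isClosed_iInter fun i => isClosed_iInter fun x => isClosed_iInter fun y =>
      isClosed_le (by fun_prop) (by fun_prop)
  convert hprod.inter_right hIC using 1
  ext p
  simp only [feasible, Set.mem_ofPred_eq, Set.mem_inter_iff, Set.mem_prod, Set.mem_univ_pi]
  tauto

theorem isCompact_Phi (G : StochasticGame n S A) {V : S → Set (Fin (n + 1) → ℝ)}
    (hV : ∀ s, IsCompact (V s)) (s : S) : IsCompact (G.Phi V s) := by
  rw [Phi_eq_image]
  exact (G.isCompact_feasible hV s).image (G.continuous_bellman s)

/-- Along a decreasing sequence of compact value sets, a vector in the image under `Phi` of every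
term lies in the image of the intersection: the pairs realising it at each stage form a decreasing
sequence of nonempty compact sets. -/
theorem iInter_Phi_subset (G : StochasticGame n S A) {V : ℕ → S → Set (Fin (n + 1) → ℝ)}
    (hanti : Antitone V) (hV : ∀ k s, IsCompact (V k s)) (s : S) :
    ⋂ k, G.Phi (V k) s ⊆ G.Phi (fun s => ⋂ k, V k s) s := by
  intro v hv
  have hv : ∀ k, ((G.feasible (V k) s) ∩ {p | G.bellman s p.1 p.2 = v}).Nonempty := fun k => by
    have := Set.mem_iInter.1 hv k
    rw [Phi_eq_image] at this
    exact this
  have hcl : IsClosed {p : (JointAction n A → ℝ) ×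
      (JointAction n A → JointAction n A → S → Fin (n + 1) → ℝ) | G.bellman s p.1 p.2 = v} :=
    isClosed_eq (G.continuous_bellman s) continuous_const
  have hK : ∀ k, IsCompact ((G.feasible (V k) s) ∩ {p | G.bellman s p.1 p.2 = v}) := fun k =>
    (G.isCompact_feasible (hV k) s).inter_right hcl
  obtain ⟨⟨q, w⟩, hp⟩ := IsCompact.nonempty_iInter_of_sequence_nonempty_isCompact_isClosed
    (fun k => G.feasible (V k) s ∩ {p | G.bellman s p.1 p.2 = v})
    (fun k p hp => ⟨⟨hp.1.1, hp.1.2.1, fun a b s' =>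
      hanti k.le_succ s' (hp.1.2.2 a b s')⟩, hp.2⟩) hv (hK 0) fun k => (hK k).isClosed
  have hp := Set.mem_iInter.1 hp
  exact ⟨q, w, (hp 0).1.1, (hp 0).1.2.1,
    fun a b s' => Set.mem_iInter.2 fun k => (hp k).1.2.2 a b s', (hp 0).2.symm⟩

/-- With onward values that do not depend on the actions, the incentive constraint asks for a
correlated equilibrium of a one-shot game. -/
theorem nonempty_Phi [Nonempty A] (G : StochasticGame n S A) {V : S → Set (Fin (n + 1) → ℝ)}
    (hV : ∀ s, (V s).Nonempty) (s : S) : (G.Phi V s).Nonempty := by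
  choose u hu using hV
  obtain ⟨q, hq, hce⟩ := exists_correlated_equilibrium
    fun (j : Fin (n + 1)) (a : JointAction n A) => G.lookahead s a u j
  exact ⟨_, q, fun _ _ => u, hq, fun i => hce i.succ, fun _ _ => hu, rfl⟩

end StochasticGame

/-! ### Convergence to the inducible value sets -/

theorem mainTheorem3 {n : ℕ} {S A : Type*} [Fintype S] [Fintype A] [DecidableEq A] [Nonempty A]
    (G : StochasticGame n S A) (V : ℕ → S → Set (Fin (n + 1) → ℝ))
    (hV0 : V 0 = hypercube n S) (hV : ∀ k, V (k + 1) = G.Phi (V k)) :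
    (∀ (s : S) (v v' : Fin (n + 1) → ℝ), v ∈ G.inducibleSet s → v' ∉ G.inducibleSet s →
      ∃ k₀ : ℕ, ∀ k ≥ k₀, v ∈ V k s ∧ v' ∉ V k s) ∧
    (∀ s, G.inducibleSet s = ⋂ (k : ℕ) (_ : 1 ≤ k), V k s) ∧
    (∀ s, (G.inducibleSet s).Nonempty) ∧
    IsGreatest {W : S → Set (Fin (n + 1) → ℝ) |
      (∀ s, Bornology.IsBounded (W s)) ∧ G.Phi W = W} G.inducibleSet := by
  have hanti : Antitone V := antitone_nat_of_succ_le fun k => by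
    induction k with
    | zero => rw [hV, hV0]; exact G.Phi_hypercube_le
    | succ k ih => rw [hV (k + 1), hV k]; exact G.Phi_mono (by rwa [← hV])
  have hcompact : ∀ k s, IsCompact (V k s) := fun k => by
    induction k with
    | zero => rw [hV0]; exact isCompact_hypercube
    | succ k ih => rw [hV]; exact G.isCompact_Phi ih
  have hne : ∀ k s, (V k s).Nonempty := fun k => by
    induction k with
    | zero => rw [hV0]; exact fun s => ⟨0, fun j => by norm_num⟩
    | succ k ih => rw [hV]; exact G.nonempty_Phi ih
  have hle : ∀ k, G.inducibleSet ≤ V k := fun k => by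
    induction k with
    | zero => rw [hV0]; exact G.inducibleSet_le_hypercube
    | succ k ih => rw [hV]; exact G.inducibleSet_le_Phi.trans (G.Phi_mono ih)
  have hgen : (fun s => ⋂ k, V k s) ≤ G.inducibleSet := by
    refine G.le_inducibleSet_of_le_Phi
      (fun s => (hcompact 0 s).isBounded.subset (Set.iInter_subset _ 0)) fun s v hv => ?_
    refine G.iInter_Phi_subset hanti hcompact s (Set.mem_iInter.2 fun k => ?_)
    rw [← hV]
    exact Set.mem_iInter.1 hv (k + 1)
  have hinter : ∀ s, G.inducibleSet s = ⋂ k, V k s := fun s =>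
    (Set.subset_iInter fun k => hle k s).antisymm (hgen s)
  refine ⟨fun s v v' hv hv' => ?_, fun s => ?_, fun s => ?_,
    ⟨G.isBounded_inducibleSet, G.Phi_inducibleSet⟩, fun W hW =>
      G.le_inducibleSet_of_le_Phi hW.1 hW.2.ge⟩
  · rw [hinter, Set.mem_iInter, not_forall] at hv'
    obtain ⟨k₀, hk₀⟩ := hv'
    exact ⟨k₀, fun k hk => ⟨hle k s hv, fun h => hk₀ (hanti hk s h)⟩⟩
  · refine (Set.subset_iInter₂ fun k _ => hle k s).antisymm ?_
    rw [hinter]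
    exact Set.subset_iInter fun k => (Set.iInter₂_subset (k + 1) k.succ_pos).trans
      (hanti k.le_succ s)
  · rw [hinter]
    exact IsCompact.nonempty_iInter_of_sequence_nonempty_isCompact_isClosed _
      (fun k => hanti k.le_succ s) (fun k => hne k s) (hcompact 0 s)
      fun k => (hcompact k s).isClosed
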